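/- Let $\alpha\in\mathbb R$, $0<\beta<2\pi$, and let $g:\mathbb R\to\mathbb C$ satisfy $\int_{-\infty}^{\infty}|g(\tau)|\,e^{(\beta-\pi)|\tau|}\,d\tau<\infty$, i.e. $g\in L_1(\mathbb R;e^{(\beta-\pi)|\tau|}d\tau)$. Let $$\Psi_\alpha(r,\theta)=\int_{-\infty}^{\infty}e^{\theta\tau}\,\bigl|K_{\alpha+i\tau}(\sqrt r)\bigr|^2\,g(\tau)\,d\tau$$ be its generalized Lebedev transform, where $K_\mu(x)=\int_0^\infty e^{-x\cosh t}\cosh(\mu t)\,dt$ ($x>0$, $\mu\in\mathbb C$) is the modified Bessel function of the second kind (Macdonald's function). Then for all $r>0$ and $0\le\theta<\beta$ the integral converges absolutely, $\Psi_\alpha$ (given by the same formula also for small negative $\theta$) is four times continuously differentiable in a neighbourhood of $(r,\theta)$, and $u=\Psi_\alpha$ satisfies at $(r,\theta)$ the partial differential equation $$r^3\frac{\partial^4u}{\partial r^4}+r\frac{\partial^4u}{\partial r^2\partial\theta^2}+6r^2\frac{\partial^3u}{\partial r^3}+\frac{\partial^3u}{\partial r\,\partial\theta^2}+r\,(7-\alpha^2-r)\frac{\partial^2u}{\partial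 r^2}-\frac{\alpha^2}{r}\frac{\partial^2u}{\partial\theta^2}+\Bigl(1-\alpha^2-\frac{5r}{2}\Bigr)\frac{\partial u}{\partial r}-\frac u2=0 .$$ Moreover $\lim_{r\to\infty}\Psi_\alpha(r,\theta)=0$ for every $\theta\in[0,\beta)$. -/

import Mathlib

noncomputable section

open MeasureTheory Set

/-- The modified Bessel function of the second kind (Macdonald function) `K_μ(x)` of complex
order `μ` and positive argument `x`:
`K_μ(x) = ∫_0^∞ e^{-x cosh t} cosh (μ t) dt`. The integral converges absolutely for all
`μ ∈ ℂ` and `x > 0`. -/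
def macdonaldK (μ : ℂ) (x : ℝ) : ℂ :=
  ∫ t in Ioi (0 : ℝ), (Real.exp (-x * Real.cosh t) : ℂ) * Complex.cosh (μ * (t : ℂ))

/-- The integrand `e^{θ τ} |K_{α + i τ}(√r)|² g(τ)` of the generalized Lebedev transform. -/
def lebedevIntegrand (α : ℝ) (g : ℝ → ℂ) (r θ τ : ℝ) : ℂ :=
  ((Real.exp (θ * τ) * ‖macdonaldK ((α : ℂ) + Complex.I * (τ : ℂ)) (Real.sqrt r)‖ ^ 2 : ℝ) : ℂ)
    * g τ

/-- The generalized Lebedev transform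
`Ψ_α(r, θ) = ∫_{-∞}^{∞} e^{θ τ} |K_{α + i τ}(√r)|² g(τ) dτ`. -/
def lebedevPsi (α : ℝ) (g : ℝ → ℂ) (r θ : ℝ) : ℂ :=
  ∫ τ : ℝ, lebedevIntegrand α g r θ τ

/-- The partial derivative `∂^m/∂r^m ∂^n/∂θ^n` of a function `u(r, θ)`. -/
def polarDeriv (m n : ℕ) (u : ℝ → ℝ → ℂ) (r θ : ℝ) : ℂ :=
  iteratedDeriv m (fun ρ : ℝ => iteratedDeriv n (fun ϑ : ℝ => u ρ ϑ) θ) r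

/-- The fourth order partial differential operator in polar coordinates
`r³ u_rrrr + r u_rrθθ + 6 r² u_rrr + u_rθθ + r (7 - α² - r) u_rr - (α² / r) u_θθ
  + (1 - α² - 5 r / 2) u_r - u / 2`. -/
def lebedevOperator (α : ℝ) (u : ℝ → ℝ → ℂ) (r θ : ℝ) : ℂ :=
  (r : ℂ) ^ 3 * polarDeriv 4 0 u r θ
    + (r : ℂ) * polarDeriv 2 2 u r θ
    + 6 * (r : ℂ) ^ 2 * polarDeriv 3 0 u r θ
    + polarDeriv 1 2 u r θ
    + (r : ℂ) * (7 - (α : ℂ) ^ 2 - (r : ℂ)) * polarDeriv 2 0 u r θ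
    - ((α : ℂ) ^ 2 / (r : ℂ)) * polarDeriv 0 2 u r θ
    + (1 - (α : ℂ) ^ 2 - 5 / 2 * (r : ℂ)) * polarDeriv 1 0 u r θ
    - u r θ / 2

end

noncomputable section

open MeasureTheory Set

/-! Write `K_μ(x)` as half the integral of `e^{-x cosh z + μ z}` over the real line and move the
contour to `Im z = s`, `|s| < π/2`. There `Re cosh z = cos s · cosh t`, so the integral still
converges, and for `μ = α + iτ` the modulus gains the factor `e^{-τs}`. Giving `s` the sign of `τ`
shows that `K_{α+iτ}(√r)` and all its `r`-derivatives are `O(e^{-δ|τ|})` for every `δ < π/2`,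
locally uniformly in `r` (`norm_macdonaldLine_le_exp_abs`, `smoothDecay_macdonaldLine`).

For real `α` the kernel `|K_{α+iτ}|²` equals `K_{α+iτ} K_{α-iτ}`, so it is smooth in `r` and decays
at every rate below `π`. When `|θ| < β`, this decay absorbs `e^{θτ}` up to the weight
`e^{(β-π)|τ|}`. Dominated convergence then gives absolute convergence and differentiation under the
integral (`hasFDerivAt_kernelTransform`, `contDiffOn_kernelTransform`).

Each factor solves the Bessel equation in the variable `r`, with parameters `(α ± iτ)²`, so their
product solves a fourth order equation whose coefficients are affine in `τ²` (`product_ode`). Under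
the integral `τ²` is `∂²/∂θ²`, which gives the differential equation. The limit follows from the
factor `e^{-√r cos s}` supplied by the same contour bound. -/

/-- The even majorant `e^{M|t| - y cosh t}` of the integrands representing the Macdonald function. -/
def coshMajorant (M y t : ℝ) : ℝ := Real.exp (M * |t| - y * Real.cosh t)

lemma continuous_coshMajorant (M y : ℝ) : Continuous (coshMajorant M y) := by
  unfold coshMajorant; fun_prop

lemma coshMajorant_anti {M y y' : ℝ} (h : y ≤ y') (t : ℝ) :
    coshMajorant M y' t ≤ coshMajorant M y t := by
  unfold coshMajorant
  have := Real.cosh_pos t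
  gcongr

/-- Uses `cosh t ≥ 1`; this is the source of decay as the argument of the Macdonald function grows.
-/
lemma coshMajorant_le_exp_mul {M y y' : ℝ} (h : y ≤ y') (t : ℝ) :
    coshMajorant M y' t ≤ Real.exp (-(y' - y)) * coshMajorant M y t := by
  unfold coshMajorant
  rw [← Real.exp_add, Real.exp_le_exp]
  nlinarith [Real.one_le_cosh t]

lemma sq_div_four_le_cosh (t : ℝ) : t ^ 2 / 4 ≤ Real.cosh t := by
  rw [← Real.cosh_abs, Real.cosh_eq]
  have h := Real.quadratic_le_exp_of_nonneg (abs_nonneg t)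
  have := Real.exp_pos (-|t|)
  have := abs_nonneg t
  rw [sq_abs] at h
  linarith

lemma integrable_coshMajorant (M : ℝ) {y : ℝ} (hy : 0 < y) : Integrable (coshMajorant M y) := by
  have hq : ∀ c : ℝ, Integrable (fun t : ℝ => Real.exp (-(y / 4) * t ^ 2 + c * t)) := by
    intro c
    have h := (integrable_cexp_quadratic (b := ((y / 4 : ℝ) : ℂ))
      (by rw [Complex.ofReal_re]; positivity) c 0).norm
    refine h.congr (Filter.Eventually.of_forall fun t => ?_)
    simp only [Complex.norm_exp]
    congr 1
    have : -((y / 4 : ℝ) : ℂ) * (t : ℂ) ^ 2 + (c : ℂ) * t + 0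
        = ((-(y / 4) * t ^ 2 + c * t : ℝ) : ℂ) := by push_cast; ring
    rw [this, Complex.ofReal_re]
  -- Since `cosh t ≥ t²/4`, the majorant is at most one of the Gaussians with linear term `±Mt`,
  -- according to the sign of `t`, hence at most their sum.
  refine ((hq M).add (hq (-M))).mono' (continuous_coshMajorant M y).aestronglyMeasurable
    (Filter.Eventually.of_forall fun t => ?_)
  have hc := sq_div_four_le_cosh t
  rw [coshMajorant, Real.norm_of_nonneg (Real.exp_pos _).le, Pi.add_apply]
  have h1 := Real.exp_pos (-(y / 4) * t ^ 2 + M * t)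
  have h2 := Real.exp_pos (-(y / 4) * t ^ 2 + -M * t)
  rcases abs_choice t with h | h
  · refine le_trans (Real.exp_le_exp.2 (?_ : _ ≤ -(y / 4) * t ^ 2 + M * t)) (by linarith)
    rw [h]; nlinarith
  · refine le_trans (Real.exp_le_exp.2 (?_ : _ ≤ -(y / 4) * t ^ 2 + -M * t)) (by linarith)
    rw [h]; nlinarith

/-! ### Line integrals for the Macdonald function -/

lemma Complex.norm_cosh_le (z : ℂ) : ‖Complex.cosh z‖ ≤ Real.exp |z.re| := by
  rw [Complex.cosh, norm_div, Complex.norm_ofNat]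
  have h := norm_add_le (Complex.exp z) (Complex.exp (-z))
  rw [Complex.norm_exp, Complex.norm_exp, Complex.neg_re] at h
  have h1 := Real.exp_le_exp.2 (le_abs_self z.re)
  have h2 := Real.exp_le_exp.2 (neg_le_abs z.re)
  linarith

lemma Complex.norm_sinh_le (z : ℂ) : ‖Complex.sinh z‖ ≤ Real.exp |z.re| := by
  rw [Complex.sinh, norm_div, Complex.norm_ofNat]
  have h := norm_sub_le (Complex.exp z) (Complex.exp (-z))
  rw [Complex.norm_exp, Complex.norm_exp, Complex.neg_re] at h
  have h1 := Real.exp_le_exp.2 (le_abs_self z.re)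
  have h2 := Real.exp_le_exp.2 (neg_le_abs z.re)
  linarith

lemma Complex.cosh_add_mul_I_re (t s : ℝ) :
    (Complex.cosh (t + s * Complex.I)).re = Real.cosh t * Real.cos s := by
  rw [Complex.cosh_add, Complex.cosh_mul_I, Complex.sinh_mul_I, ← Complex.ofReal_cosh,
    ← Complex.ofReal_sinh, ← Complex.ofReal_cos, ← Complex.ofReal_sin]
  simp [-Complex.ofReal_cos, -Complex.ofReal_cosh, -Complex.ofReal_sin, -Complex.ofReal_sinh]

/-- The factor `e^{-(Im μ) s}` is the gain from leaving the real axis; its price is `x cos s` in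
place of `x`. -/
lemma norm_exp_macdonald (s : ℝ) (μ : ℂ) (x t : ℝ) :
    ‖Complex.exp (-x * Complex.cosh (t + s * Complex.I) + μ * (t + s * Complex.I))‖
      = Real.exp (-(μ.im * s)) * Real.exp (μ.re * t - x * Real.cos s * Real.cosh t) := by
  rw [Complex.norm_exp, ← Real.exp_add]
  congr 1
  have h := Complex.cosh_add_mul_I_re t s
  simp only [Complex.add_re, Complex.mul_re, Complex.neg_re, Complex.neg_im, Complex.ofReal_re,
    Complex.ofReal_im, h, Complex.I_re, Complex.I_im, Complex.add_im, Complex.mul_im]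
  ring

/-- The integrand of the `k`-th derivative in `x` of the Macdonald function on the line
`Im z = s`. -/
def macdonaldIntegrand (s : ℝ) (k : ℕ) (μ : ℂ) (x t : ℝ) : ℂ :=
  (-Complex.cosh (t + s * Complex.I)) ^ k *
    Complex.exp (-x * Complex.cosh (t + s * Complex.I) + μ * (t + s * Complex.I))

/-- The `k`-th derivative in `x` of the Macdonald function, as an integral over `Im z = s`. -/
def macdonaldLine (s : ℝ) (k : ℕ) (μ : ℂ) (x : ℝ) : ℂ :=
  (1 / 2) * ∫ t : ℝ, macdonaldIntegrand s k μ x t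

lemma continuous_macdonaldIntegrand (s : ℝ) (k : ℕ) (μ : ℂ) (x : ℝ) :
    Continuous (macdonaldIntegrand s k μ x) := by
  unfold macdonaldIntegrand
  fun_prop

lemma exp_re_mul_le_coshMajorant {m M : ℝ} (hm : |m| ≤ M) (y t : ℝ) :
    Real.exp (m * t - y * Real.cosh t) ≤ coshMajorant M y t := by
  unfold coshMajorant
  rw [Real.exp_le_exp]
  have h := (le_abs_self (m * t)).trans (abs_mul m t).le
  have := mul_le_mul_of_nonneg_right hm (abs_nonneg t)
  linarith

lemma norm_macdonaldIntegrand_le (s : ℝ) (k : ℕ) (μ : ℂ) (x t : ℝ) :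
    ‖macdonaldIntegrand s k μ x t‖
      ≤ Real.exp (-(μ.im * s)) * coshMajorant (k + |μ.re|) (x * Real.cos s) t := by
  unfold macdonaldIntegrand
  rw [norm_mul, norm_exp_macdonald, norm_pow, norm_neg]
  have h := pow_le_pow_left₀ (norm_nonneg _) (Complex.norm_cosh_le (t + s * Complex.I)) k
  have hre : ((t : ℂ) + s * Complex.I).re = t := by simp
  rw [hre, ← Real.exp_nat_mul] at h
  have h2 := exp_re_mul_le_coshMajorant (le_refl |μ.re|) (x * Real.cos s) t
  calc _ ≤ Real.exp (k * |t|) * (Real.exp (-(μ.im * s)) *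
            coshMajorant |μ.re| (x * Real.cos s) t) := by gcongr
    _ = _ := by
      unfold coshMajorant
      rw [← Real.exp_add, ← Real.exp_add, ← Real.exp_add]
      congr 1; ring

lemma integrable_macdonaldIntegrand {s : ℝ} (hs : 0 < Real.cos s) (k : ℕ) (μ : ℂ) {x : ℝ}
    (hx : 0 < x) : Integrable (macdonaldIntegrand s k μ x) :=
  ((integrable_coshMajorant (k + |μ.re|) (mul_pos hx hs)).const_mul _).mono'
    (continuous_macdonaldIntegrand s k μ x).aestronglyMeasurable
    (Filter.Eventually.of_forall fun t => norm_macdonaldIntegrand_le s k μ x t)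

lemma hasDerivAt_macdonaldIntegrand (s : ℝ) (k : ℕ) (μ : ℂ) (x t : ℝ) :
    HasDerivAt (fun y : ℝ => macdonaldIntegrand s k μ y t) (macdonaldIntegrand s (k + 1) μ x t)
      x := by
  unfold macdonaldIntegrand
  set c := Complex.cosh (t + s * Complex.I)
  have h : HasDerivAt (fun y : ℂ => -y * c + μ * (t + s * Complex.I)) (-1 * c) (x : ℂ) :=
    ((hasDerivAt_id (x : ℂ)).neg.mul_const c).add_const _
  refine ((h.cexp.const_mul ((-c) ^ k)).comp_ofReal).congr_deriv ?_
  ring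

lemma hasDerivAt_macdonaldLine {s : ℝ} (hs : 0 < Real.cos s) (k : ℕ) (μ : ℂ) {x : ℝ}
    (hx : 0 < x) :
    HasDerivAt (macdonaldLine s k μ) (macdonaldLine s (k + 1) μ x) x := by
  have h := hasDerivAt_integral_of_dominated_loc_of_deriv_le (μ := volume)
    (F := fun y t => macdonaldIntegrand s k μ y t) (x₀ := x) (s := Ioi (x / 2))
    (F' := fun y t => macdonaldIntegrand s (k + 1) μ y t)
    (bound := fun t => Real.exp (-(μ.im * s)) *
      coshMajorant ((k + 1 : ℕ) + |μ.re|) (x / 2 * Real.cos s) t)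
    (Ioi_mem_nhds (by linarith))
    (Filter.Eventually.of_forall fun y =>
      (continuous_macdonaldIntegrand s k μ y).aestronglyMeasurable)
    (integrable_macdonaldIntegrand hs k μ hx)
    (continuous_macdonaldIntegrand s (k + 1) μ x).aestronglyMeasurable
    (Filter.Eventually.of_forall fun t y hy => by
      refine (norm_macdonaldIntegrand_le s (k + 1) μ y t).trans ?_
      refine mul_le_mul_of_nonneg_left (coshMajorant_anti ?_ t) (Real.exp_pos _).le
      exact mul_le_mul_of_nonneg_right (le_of_lt hy) hs.le)
    ((integrable_coshMajorant _ (by positivity)).const_mul _)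
    (Filter.Eventually.of_forall fun t y _ => hasDerivAt_macdonaldIntegrand s k μ y t)
  exact h.2.const_mul (1 / 2)

/-! ### Independence of the contour -/

/-- The derivative in `z` of `e^{-x cosh z + μ z}`. -/
lemma hasDerivAt_exp_macdonald (μ : ℂ) (x : ℝ) (z : ℂ) :
    HasDerivAt (fun z : ℂ => Complex.exp (-x * Complex.cosh z + μ * z))
      ((-x * Complex.sinh z + μ) * Complex.exp (-x * Complex.cosh z + μ * z)) z := by
  have h := (((Complex.hasDerivAt_cosh z).const_mul (-(x : ℂ))).add
    ((hasDerivAt_id z).const_mul μ)).cexp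
  refine h.congr_deriv ?_
  simp [mul_comm]

lemma norm_macdonald_deriv_le (s : ℝ) (μ : ℂ) {x : ℝ} (hx : 0 ≤ x) (t : ℝ) :
    ‖(-x * Complex.sinh (t + s * Complex.I) + μ) *
      Complex.exp (-x * Complex.cosh (t + s * Complex.I) + μ * (t + s * Complex.I))‖
      ≤ (x + ‖μ‖) * (Real.exp (-(μ.im * s)) *
        coshMajorant (1 + |μ.re|) (x * Real.cos s) t) := by
  rw [norm_mul, norm_exp_macdonald]
  have h := Complex.norm_sinh_le (t + s * Complex.I)
  have hre : ((t : ℂ) + s * Complex.I).re = t := by simp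
  rw [hre] at h
  have h0 : 1 ≤ Real.exp |t| := Real.one_le_exp (abs_nonneg t)
  have h1 : ‖-x * Complex.sinh (t + s * Complex.I) + μ‖ ≤ (x + ‖μ‖) * Real.exp |t| := by
    refine (norm_add_le _ _).trans ?_
    rw [norm_mul, norm_neg, Complex.norm_real, Real.norm_of_nonneg hx, add_mul]
    have := norm_nonneg μ
    gcongr
    nlinarith
  have h2 := exp_re_mul_le_coshMajorant (le_refl |μ.re|) (x * Real.cos s) t
  calc _ ≤ ((x + ‖μ‖) * Real.exp |t|) * (Real.exp (-(μ.im * s)) *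
            coshMajorant |μ.re| (x * Real.cos s) t) := by gcongr
    _ = (x + ‖μ‖) * (Real.exp |t| * (Real.exp (-(μ.im * s)) *
            coshMajorant |μ.re| (x * Real.cos s) t)) := by ring
    _ = _ := by
      unfold coshMajorant
      rw [← Real.exp_add, ← Real.exp_add, ← Real.exp_add]
      congr 2; ring

lemma integrable_macdonald_deriv {s : ℝ} (hs : 0 < Real.cos s) (μ : ℂ) {x : ℝ} (hx : 0 < x) :
    Integrable (fun t : ℝ => (-x * Complex.sinh (t + s * Complex.I) + μ) *
      Complex.exp (-x * Complex.cosh (t + s * Complex.I) + μ * (t + s * Complex.I))) := by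
  refine (((integrable_coshMajorant (1 + |μ.re|) (mul_pos hx hs)).const_mul _).const_mul _).mono'
    (Continuous.aestronglyMeasurable ?_)
    (Filter.Eventually.of_forall fun t => norm_macdonald_deriv_le s μ hx.le t)
  fun_prop

lemma integral_macdonald_deriv {s : ℝ} (hs : 0 < Real.cos s) (μ : ℂ) {x : ℝ} (hx : 0 < x) :
    ∫ t : ℝ, (-x * Complex.sinh (t + s * Complex.I) + μ) *
      Complex.exp (-x * Complex.cosh (t + s * Complex.I) + μ * (t + s * Complex.I)) = 0 := by
  refine integral_eq_zero_of_hasDerivAt_of_integrable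
    (f := fun t : ℝ => Complex.exp (-x * Complex.cosh (t + s * Complex.I)
      + μ * (t + s * Complex.I))) (fun t => ?_) (integrable_macdonald_deriv hs μ hx) ?_
  · have h := (hasDerivAt_exp_macdonald μ x (t + s * Complex.I)).comp (t : ℂ)
      ((hasDerivAt_id (t : ℂ)).add_const (s * Complex.I))
    simpa using h.comp_ofReal
  · refine (integrable_macdonaldIntegrand hs 0 μ hx).congr
      (Filter.Eventually.of_forall fun t => ?_)
    simp only [macdonaldIntegrand, pow_zero, one_mul]

/-- Plays the role of Cauchy's theorem: for holomorphic `f`, `∂_s f(t + is) = i ∂_t f(t + is)`, and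
the integral over `t` of the right side vanishes. -/
lemma hasDerivAt_macdonaldLine_shift {s : ℝ} (hs : s ∈ Ioo (-(Real.pi / 2)) (Real.pi / 2))
    (μ : ℂ) {x : ℝ} (hx : 0 < x) :
    HasDerivAt (fun σ : ℝ => macdonaldLine σ 0 μ x) 0 s := by
  -- Keeping `|σ| < a < π/2` gives `cos σ ≥ cos a > 0`, hence one majorant for all nearby lines.
  obtain ⟨a, ha, hsa⟩ : ∃ a, |s| < a ∧ a < Real.pi / 2 := exists_between (abs_lt.2 hs)
  have ha0 : 0 ≤ a := (abs_nonneg s).trans ha.le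
  have hca : 0 < Real.cos a := Real.cos_pos_of_mem_Ioo ⟨by linarith, hsa⟩
  have hsc : 0 < Real.cos s := Real.cos_pos_of_mem_Ioo hs
  have hcos : ∀ σ ∈ Ioo (-a) a, Real.cos a ≤ Real.cos σ := by
    intro σ hσ
    rw [← Real.cos_abs σ]
    exact Real.cos_le_cos_of_nonneg_of_le_pi (abs_nonneg σ) (by linarith [Real.pi_pos])
      (abs_lt.2 hσ).le
  have h := hasDerivAt_integral_of_dominated_loc_of_deriv_le (μ := volume)
    (F := fun σ t => macdonaldIntegrand σ 0 μ x t) (x₀ := s) (s := Ioo (-a) a)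
    (F' := fun σ t => (-x * Complex.sinh (t + σ * Complex.I) + μ) *
      Complex.exp (-x * Complex.cosh (t + σ * Complex.I) + μ * (t + σ * Complex.I)) * Complex.I)
    (bound := fun t => (x + ‖μ‖) * (Real.exp (|μ.im| * a) *
      coshMajorant (1 + |μ.re|) (x * Real.cos a) t))
    (Ioo_mem_nhds (abs_lt.1 ha).1 (abs_lt.1 ha).2)
    (Filter.Eventually.of_forall fun y =>
      (continuous_macdonaldIntegrand y 0 μ x).aestronglyMeasurable)
    (integrable_macdonaldIntegrand hsc 0 μ hx)
    ((integrable_macdonald_deriv hsc μ hx).mul_const _).aestronglyMeasurable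
    (Filter.Eventually.of_forall fun t σ hσ => by
      rw [norm_mul, Complex.norm_I, mul_one]
      refine (norm_macdonald_deriv_le σ μ hx.le t).trans ?_
      have h1 : -(μ.im * σ) ≤ |μ.im| * a := by
        refine (neg_le_abs _).trans ?_
        rw [abs_mul]
        exact mul_le_mul_of_nonneg_left (abs_lt.2 hσ).le (abs_nonneg _)
      have h2 := coshMajorant_anti (M := 1 + |μ.re|)
        (mul_le_mul_of_nonneg_left (hcos σ hσ) hx.le) t
      have h3 : 0 ≤ coshMajorant (1 + |μ.re|) (x * Real.cos σ) t := (Real.exp_pos _).le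
      have h4 := norm_nonneg μ
      gcongr)
    (((integrable_coshMajorant _ (by positivity)).const_mul _).const_mul _)
    (Filter.Eventually.of_forall fun t σ _ => by
      have h := (hasDerivAt_exp_macdonald μ x (t + σ * Complex.I)).comp (σ : ℂ)
        (((hasDerivAt_id (σ : ℂ)).mul_const Complex.I).const_add (t : ℂ))
      simpa [macdonaldIntegrand, Function.comp_def] using h.comp_ofReal)
  have h' := h.2.const_mul (1 / 2 : ℂ)
  rwa [integral_mul_const, integral_macdonald_deriv hsc μ hx, zero_mul, mul_zero] at h'

lemma cos_pos_of_abs_lt {s : ℝ} (hs : |s| < Real.pi / 2) : 0 < Real.cos s :=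
  Real.cos_pos_of_mem_Ioo (abs_lt.1 hs)

/-- The line integral does not depend on the line. -/
lemma macdonaldLine_eq {s : ℝ} (hs : |s| < Real.pi / 2) (k : ℕ) (μ : ℂ) {x : ℝ} (hx : 0 < x) :
    macdonaldLine s k μ x = macdonaldLine 0 k μ x := by
  induction k generalizing x with
  | zero =>
    have hd : ∀ σ ∈ Ioo (-(Real.pi / 2)) (Real.pi / 2),
        HasDerivAt (fun σ : ℝ => macdonaldLine σ 0 μ x) 0 σ :=
      fun σ hσ => hasDerivAt_macdonaldLine_shift hσ μ hx
    exact isOpen_Ioo.is_const_of_deriv_eq_zero (f := fun σ : ℝ => macdonaldLine σ 0 μ x)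
      isPreconnected_Ioo (fun σ hσ => (hd σ hσ).differentiableAt.differentiableWithinAt)
      (fun σ hσ => (hd σ hσ).deriv) (abs_lt.1 hs)
      ⟨by linarith [Real.pi_pos], by linarith [Real.pi_pos]⟩
  | succ k ih =>
    have h1 := hasDerivAt_macdonaldLine (cos_pos_of_abs_lt hs) k μ hx
    have h2 := hasDerivAt_macdonaldLine (s := 0) (by simp) k μ hx
    -- Both sides are `x`-derivatives of functions that agree on `x > 0` by induction.
    refine h1.unique (h2.congr_of_eventuallyEq ?_)
    filter_upwards [Ioi_mem_nhds hx] with y hy using ih hy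

/-- The part `y` of `x` is kept to make the integral converge, with a constant independent of `x`;
the rest, `x - y`, is spent on exponential decay. -/
lemma norm_macdonaldLine_le {s : ℝ} (hs : |s| < Real.pi / 2) (k : ℕ) (μ : ℂ) {x y : ℝ}
    (hy : 0 < y) (hyx : y ≤ x) :
    ‖macdonaldLine 0 k μ x‖ ≤ Real.exp (-(μ.im * s)) * Real.exp (-((x - y) * Real.cos s)) *
      ∫ t : ℝ, coshMajorant (k + |μ.re|) (y * Real.cos s) t := by
  have hc := cos_pos_of_abs_lt hs
  have hI := integrable_coshMajorant (k + |μ.re|) (mul_pos hy hc)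
  rw [← macdonaldLine_eq hs k μ (hy.trans_le hyx), macdonaldLine, norm_mul, ← integral_const_mul]
  have h : ‖∫ t : ℝ, macdonaldIntegrand s k μ x t‖ ≤ ∫ t : ℝ, Real.exp (-(μ.im * s)) *
      Real.exp (-((x - y) * Real.cos s)) * coshMajorant (k + |μ.re|) (y * Real.cos s) t := by
    refine norm_integral_le_of_norm_le (hI.const_mul _) (Filter.Eventually.of_forall fun t => ?_)
    refine (norm_macdonaldIntegrand_le s k μ x t).trans ?_
    rw [mul_assoc, sub_mul]
    exact mul_le_mul_of_nonneg_left
      (coshMajorant_le_exp_mul (mul_le_mul_of_nonneg_right hyx hc.le) t) (Real.exp_pos _).le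
  have h1 : ‖(1 / 2 : ℂ)‖ = 1 / 2 := by norm_num
  rw [h1]
  linarith [norm_nonneg (∫ t : ℝ, macdonaldIntegrand s k μ x t)]

/-! ### Bessel equation and identification with `macdonaldK` -/

lemma macdonaldIntegrand_zero_shift (k : ℕ) (μ : ℂ) (x t : ℝ) :
    macdonaldIntegrand 0 k μ x t
      = (-Complex.cosh t) ^ k * Complex.exp (-x * Complex.cosh t + μ * t) := by
  simp [macdonaldIntegrand]

/-- The modified Bessel equation. -/
lemma macdonaldLine_bessel (μ : ℂ) {x : ℝ} (hx : 0 < x) :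
    (x : ℂ) ^ 2 * macdonaldLine 0 2 μ x + x * macdonaldLine 0 1 μ x
      = ((x : ℂ) ^ 2 + μ ^ 2) * macdonaldLine 0 0 μ x := by
  have hi : ∀ k, Integrable (macdonaldIntegrand 0 k μ x) := fun k =>
    integrable_macdonaldIntegrand (by simp) k μ hx
  -- With `cosh² = 1 + sinh²`, the Bessel operator applied to the integrand is, up to sign, a total
  -- `t`-derivative.
  have hd : ∀ t : ℝ, HasDerivAt (fun t : ℝ => (x * Complex.sinh t + μ) *
        Complex.exp (-x * Complex.cosh t + μ * t))
      ((x : ℂ) ^ 2 * macdonaldIntegrand 0 0 μ x t + μ ^ 2 * macdonaldIntegrand 0 0 μ x t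
        - (x : ℂ) ^ 2 * macdonaldIntegrand 0 2 μ x t - x * macdonaldIntegrand 0 1 μ x t) t := by
    intro t
    have h := ((((Complex.hasDerivAt_sinh (t : ℂ)).const_mul (x : ℂ)).add_const μ).mul
      (hasDerivAt_exp_macdonald μ x t)).comp_ofReal
    refine h.congr_deriv ?_
    simp only [macdonaldIntegrand_zero_shift]
    linear_combination (-(x : ℂ) ^ 2 * Complex.exp (-x * Complex.cosh t + μ * t)) *
      Complex.sinh_sq (t : ℂ)
  have hint : Integrable (fun t : ℝ => (x * Complex.sinh t + μ) *
        Complex.exp (-x * Complex.cosh t + μ * t)) := by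
    have h := integrable_macdonald_deriv (s := 0) (by simp) μ hx
    have h0 := ((hi 0).const_mul (2 * μ)).sub h
    refine h0.congr (Filter.Eventually.of_forall fun t => ?_)
    simp only [Pi.sub_apply, macdonaldIntegrand_zero_shift]
    simp
    ring
  have h1 : Integrable (fun t => (x : ℂ) ^ 2 * macdonaldIntegrand 0 0 μ x t) := (hi 0).const_mul _
  have h2 : Integrable (fun t => μ ^ 2 * macdonaldIntegrand 0 0 μ x t) := (hi 0).const_mul _
  have h3 : Integrable (fun t => (x : ℂ) ^ 2 * macdonaldIntegrand 0 2 μ x t) := (hi 2).const_mul _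
  have h4 : Integrable (fun t => (x : ℂ) * macdonaldIntegrand 0 1 μ x t) := (hi 1).const_mul _
  have h12 : Integrable (fun t => (x : ℂ) ^ 2 * macdonaldIntegrand 0 0 μ x t
    + μ ^ 2 * macdonaldIntegrand 0 0 μ x t) := h1.add h2
  have h123 : Integrable (fun t => (x : ℂ) ^ 2 * macdonaldIntegrand 0 0 μ x t
    + μ ^ 2 * macdonaldIntegrand 0 0 μ x t - (x : ℂ) ^ 2 * macdonaldIntegrand 0 2 μ x t) :=
    h12.sub h3
  have h := integral_eq_zero_of_hasDerivAt_of_integrable hd (h123.sub h4) hint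
  rw [integral_sub h123 h4, integral_sub h12 h3, integral_add h1 h2,
    integral_const_mul, integral_const_mul, integral_const_mul, integral_const_mul] at h
  simp only [macdonaldLine]
  linear_combination (-1 / 2 : ℂ) * h

/-- Folding the real line at `0` combines `e^{μt}` and `e^{-μt}` into `2 cosh (μt)`. -/
lemma macdonaldK_eq_macdonaldLine (μ : ℂ) {x : ℝ} (hx : 0 < x) :
    macdonaldK μ x = macdonaldLine 0 0 μ x := by
  set f : ℝ → ℂ := fun t => Complex.exp (-x * Complex.cosh t + μ * t) with hf
  have hfi : Integrable f := by
    refine (integrable_macdonaldIntegrand (s := 0) (by simp) 0 μ hx).congr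
      (Filter.Eventually.of_forall fun t => ?_)
    simp only [macdonaldIntegrand_zero_shift, hf, pow_zero, one_mul]
  have hneg : Integrable (fun t => f (-t)) := hfi.comp_neg
  have hsplit : ∫ t, f t = (∫ t in Ioi (0 : ℝ), f (-t)) + ∫ t in Ioi (0 : ℝ), f t := by
    rw [integral_comp_neg_Ioi, neg_zero]
    exact (intervalIntegral.integral_Iic_add_Ioi hfi.integrableOn hfi.integrableOn).symm
  have hl : macdonaldLine 0 0 μ x = (1 / 2) * ∫ t, f t := by
    unfold macdonaldLine
    simp only [macdonaldIntegrand_zero_shift, hf, pow_zero, one_mul]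
  rw [hl, hsplit, ← integral_add hneg.integrableOn hfi.integrableOn, ← integral_const_mul,
    macdonaldK]
  congr 1
  ext t
  simp only [hf]
  rw [Complex.exp_add, Complex.exp_add,
    show Complex.cosh (μ * t) = (Complex.exp (μ * t) + Complex.exp (-(μ * t))) / 2 from rfl]
  push_cast
  rw [Complex.cosh_neg]
  ring_nf

/-! ### Calculus of kernels decaying exponentially in `τ` -/

/-- `F r τ` is measurable in `τ` and decays like `e^{-δ|τ|}` for every `δ < D`, locally uniformly
in `r > 0`. -/
def HasExpDecay (D : ℝ) (F : ℝ → ℝ → ℂ) : Prop :=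
  (∀ r, 0 < r → Measurable (F r)) ∧
    ∀ a b δ, 0 < a → δ < D → ∃ C, ∀ r ∈ Icc a b, ∀ τ, ‖F r τ‖ ≤ C * Real.exp (-δ * |τ|)

/-- `F` has `k` successive derivatives in `r > 0`, all of exponential decay of type `D`. -/
def SmoothDecay (D : ℝ) : ℕ → (ℝ → ℝ → ℂ) → Prop
  | 0, F => HasExpDecay D F
  | k + 1, F => HasExpDecay D F ∧ ∃ F' : ℝ → ℝ → ℂ,
      (∀ r, 0 < r → ∀ τ, HasDerivAt (fun ρ => F ρ τ) (F' r τ) r) ∧ SmoothDecay D k F'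

lemma SmoothDecay.hasExpDecay {D : ℝ} {k : ℕ} {F : ℝ → ℝ → ℂ} (h : SmoothDecay D k F) :
    HasExpDecay D F := by
  cases k with
  | zero => exact h
  | succ k => exact h.1

lemma SmoothDecay.of_succ {D : ℝ} {k : ℕ} {F : ℝ → ℝ → ℂ} (h : SmoothDecay D (k + 1) F) :
    SmoothDecay D k F := by
  induction k generalizing F with
  | zero => exact h.1
  | succ k ih =>
    obtain ⟨h0, F', hF', h'⟩ := h
    exact ⟨h0, F', hF', ih h'⟩

lemma HasExpDecay.add {D : ℝ} {F G : ℝ → ℝ → ℂ} (hF : HasExpDecay D F) (hG : HasExpDecay D G) :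
    HasExpDecay D (fun r τ => F r τ + G r τ) := by
  refine ⟨fun r hr => (hF.1 r hr).add (hG.1 r hr), fun a b δ ha hδ => ?_⟩
  obtain ⟨C₁, h₁⟩ := hF.2 a b δ ha hδ
  obtain ⟨C₂, h₂⟩ := hG.2 a b δ ha hδ
  refine ⟨C₁ + C₂, fun r hr τ => (norm_add_le _ _).trans ?_⟩
  rw [add_mul]
  exact add_le_add (h₁ r hr τ) (h₂ r hr τ)

lemma HasExpDecay.mul {D E : ℝ} {F G : ℝ → ℝ → ℂ} (hF : HasExpDecay D F)
    (hG : HasExpDecay E G) : HasExpDecay (D + E) (fun r τ => F r τ * G r τ) := by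
  refine ⟨fun r hr => (hF.1 r hr).mul (hG.1 r hr), fun a b δ ha hδ => ?_⟩
  -- The slack `D + E - δ` is shared equally, so the two rates add up to `δ`.
  obtain ⟨C₁, h₁⟩ := hF.2 a b (D - (D + E - δ) / 2) ha (by linarith)
  obtain ⟨C₂, h₂⟩ := hG.2 a b (E - (D + E - δ) / 2) ha (by linarith)
  refine ⟨C₁ * C₂, fun r hr τ => ?_⟩
  rw [norm_mul]
  refine (mul_le_mul (h₁ r hr τ) (h₂ r hr τ) (norm_nonneg _)
    ((norm_nonneg _).trans (h₁ r hr τ))).trans_eq ?_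
  rw [mul_mul_mul_comm, ← Real.exp_add]
  congr 2; ring

lemma SmoothDecay.add {D : ℝ} {k : ℕ} {F G : ℝ → ℝ → ℂ} (hF : SmoothDecay D k F)
    (hG : SmoothDecay D k G) : SmoothDecay D k (fun r τ => F r τ + G r τ) := by
  induction k generalizing F G with
  | zero => exact HasExpDecay.add hF hG
  | succ k ih =>
    obtain ⟨hF0, F', hF', hF1⟩ := hF
    obtain ⟨hG0, G', hG', hG1⟩ := hG
    exact ⟨hF0.add hG0, _, fun r hr τ => (hF' r hr τ).add (hG' r hr τ), ih hF1 hG1⟩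

lemma SmoothDecay.mul {D E : ℝ} {k : ℕ} {F G : ℝ → ℝ → ℂ} (hF : SmoothDecay D k F)
    (hG : SmoothDecay E k G) : SmoothDecay (D + E) k (fun r τ => F r τ * G r τ) := by
  induction k generalizing F G with
  | zero => exact HasExpDecay.mul hF hG
  | succ k ih =>
    have hF2 := hF.of_succ
    have hG2 := hG.of_succ
    obtain ⟨hF0, F', hF', hF1⟩ := hF
    obtain ⟨hG0, G', hG', hG1⟩ := hG
    exact ⟨hF0.mul hG0, _, fun r hr τ => (hF' r hr τ).mul (hG' r hr τ),
      (ih hF1 hG2).add (ih hF2 hG1)⟩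

lemma SmoothDecay.comp_neg {D : ℝ} {k : ℕ} {F : ℝ → ℝ → ℂ} (hF : SmoothDecay D k F) :
    SmoothDecay D k (fun r τ => F r (-τ)) := by
  have h0 : ∀ {F : ℝ → ℝ → ℂ}, HasExpDecay D F → HasExpDecay D (fun r τ => F r (-τ)) := by
    intro F hF
    refine ⟨fun r hr => (hF.1 r hr).comp measurable_neg, fun a b δ ha hδ => ?_⟩
    obtain ⟨C, h⟩ := hF.2 a b δ ha hδ
    exact ⟨C, fun r hr τ => by simpa using h r hr (-τ)⟩
  induction k generalizing F with
  | zero => exact h0 hF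
  | succ k ih =>
    obtain ⟨hF0, F', hF', hF1⟩ := hF
    exact ⟨h0 hF0, _, fun r hr τ => hF' r hr (-τ), ih hF1⟩

lemma SmoothDecay.zero (D : ℝ) (k : ℕ) : SmoothDecay D k (fun _ _ => 0) := by
  have h0 : HasExpDecay D (fun _ _ => 0) :=
    ⟨fun _ _ => measurable_const, fun _ _ _ _ _ => ⟨0, by simp⟩⟩
  induction k with
  | zero => exact h0
  | succ k ih => exact ⟨h0, _, fun r _ _ => hasDerivAt_const r 0, ih⟩

/-- Type `0` only asks for bounds with `δ < 0`, that is, subexponential growth. Powers of `τ`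
therefore do not lower the type of a kernel; the constant `(-δ)⁻¹` comes from `x + 1 ≤ e^x`. -/
lemma SmoothDecay.id (k : ℕ) : SmoothDecay 0 k (fun _ τ => (τ : ℂ)) := by
  have h0 : HasExpDecay 0 (fun _ τ => (τ : ℂ)) := by
    refine ⟨fun _ _ => Complex.measurable_ofReal, fun a b δ _ hδ => ⟨(-δ)⁻¹, fun r _ τ => ?_⟩⟩
    rw [Complex.norm_real, Real.norm_eq_abs, ← div_eq_inv_mul, le_div_iff₀ (by linarith)]
    linarith [Real.add_one_le_exp (-δ * |τ|)]
  cases k with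
  | zero => exact h0
  | succ k => exact ⟨h0, _, fun r _ τ => hasDerivAt_const r (τ : ℂ), SmoothDecay.zero 0 k⟩

lemma SmoothDecay.id_pow_mul {D : ℝ} {k : ℕ} {F : ℝ → ℝ → ℂ} (hF : SmoothDecay D k F) (n : ℕ) :
    SmoothDecay D k (fun r τ => (τ : ℂ) ^ n * F r τ) := by
  induction n with
  | zero => simpa using hF
  | succ n ih =>
    have h := (SmoothDecay.id k).mul ih
    rw [zero_add] at h
    convert h using 3
    ring

lemma SmoothDecay.rpow (c p : ℝ) (k : ℕ) :
    SmoothDecay 0 k (fun r _ => ((c * r ^ p : ℝ) : ℂ)) := by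
  have h0 : ∀ c p : ℝ, HasExpDecay 0 (fun r _ => ((c * r ^ p : ℝ) : ℂ)) := by
    refine fun c p => ⟨fun _ _ => measurable_const, fun a b δ ha hδ => ?_⟩
    have hc : ContinuousOn (fun r : ℝ => c * r ^ p) (Icc a b) := fun r hr =>
      ((Real.continuousAt_rpow_const r p (Or.inl (ha.trans_le hr.1).ne')).const_mul
        c).continuousWithinAt
    obtain ⟨C, hC⟩ := isCompact_Icc.exists_bound_of_continuousOn hc
    refine ⟨C, fun r hr τ => ?_⟩
    rw [Complex.norm_real]
    have h1 := hC r hr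
    have h2 : 1 ≤ Real.exp (-δ * |τ|) :=
      Real.one_le_exp (mul_nonneg (by linarith) (abs_nonneg τ))
    nlinarith [norm_nonneg (c * r ^ p)]
  induction k generalizing c p with
  | zero => exact h0 c p
  | succ k ih =>
    refine ⟨h0 c p, fun r _ => (((c * p) * r ^ (p - 1) : ℝ) : ℂ), fun r hr τ => ?_, ih _ _⟩
    refine ((Real.hasDerivAt_rpow_const (Or.inl hr.ne')).const_mul c).ofReal_comp.congr_deriv ?_
    push_cast; ring

/-! ### Decay of the Lebedev kernel -/

lemma norm_macdonaldLine_le_exp_abs (α : ℝ) {s : ℝ} (hs0 : 0 ≤ s) (hs : s < Real.pi / 2) (k : ℕ)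
    {x y : ℝ} (hy : 0 < y) (hyx : y ≤ x) (τ : ℝ) :
    ‖macdonaldLine 0 k (α + Complex.I * τ) x‖ ≤ Real.exp (-s * |τ|) *
      Real.exp (-((x - y) * Real.cos s)) * ∫ t : ℝ, coshMajorant (k + |α|) (y * Real.cos s) t := by
  have him : ((α : ℂ) + Complex.I * τ).im = τ := by simp
  have hre : ((α : ℂ) + Complex.I * τ).re = α := by simp
  rcases abs_choice τ with h | h
  · have h1 := norm_macdonaldLine_le (s := s) (by rwa [abs_of_nonneg hs0]) k
      ((α : ℂ) + Complex.I * τ) hy hyx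
    rw [him, hre] at h1
    rw [h]
    convert h1 using 4
    ring
  · have h1 := norm_macdonaldLine_le (s := -s) (by rwa [abs_neg, abs_of_nonneg hs0]) k
      ((α : ℂ) + Complex.I * τ) hy hyx
    rw [him, hre, Real.cos_neg] at h1
    rw [h]
    convert h1 using 4
    ring

lemma measurable_macdonaldLine (α : ℝ) (k : ℕ) (x : ℝ) :
    Measurable (fun τ : ℝ => macdonaldLine 0 k (α + Complex.I * τ) x) := by
  have h : Continuous (Function.uncurry fun τ t : ℝ =>
      macdonaldIntegrand 0 k (α + Complex.I * τ) x t) := by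
    unfold macdonaldIntegrand Function.uncurry
    fun_prop
  exact (h.stronglyMeasurable.integral_prod_right (ν := volume)).measurable.const_mul _

lemma smoothDecay_macdonaldLine (α : ℝ) (j k : ℕ) :
    SmoothDecay (Real.pi / 2) k
      (fun r τ => macdonaldLine 0 j (α + Complex.I * τ) (Real.sqrt r)) := by
  have h0 : ∀ j, HasExpDecay (Real.pi / 2)
      (fun r τ => macdonaldLine 0 j (α + Complex.I * τ) (Real.sqrt r)) := by
    refine fun j => ⟨fun r _ => measurable_macdonaldLine α j _, fun a b δ ha hδ => ?_⟩
    -- A negative `δ` is replaced by `0`, as the contour bound takes a nonnegative shift.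
    have hs : max δ 0 < Real.pi / 2 := max_lt hδ (by positivity)
    refine ⟨∫ t : ℝ, coshMajorant (j + |α|) (Real.sqrt a * Real.cos (max δ 0)) t,
      fun r hr τ => ?_⟩
    have hC : 0 ≤ ∫ t : ℝ, coshMajorant (j + |α|) (Real.sqrt a * Real.cos (max δ 0)) t :=
      integral_nonneg fun t => (Real.exp_pos _).le
    have har : Real.sqrt a ≤ Real.sqrt r := Real.sqrt_le_sqrt hr.1
    refine (norm_macdonaldLine_le_exp_abs α (le_max_right δ 0) hs j (Real.sqrt_pos.2 ha) har
      τ).trans ?_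
    rw [mul_comm]
    refine mul_le_mul_of_nonneg_left ?_ hC
    rw [← Real.exp_add, Real.exp_le_exp]
    have h1 : 0 ≤ Real.cos (max δ 0) :=
      (cos_pos_of_abs_lt (by rwa [abs_of_nonneg (le_max_right δ 0)])).le
    have h2 := mul_nonneg (sub_nonneg.2 har) h1
    have h3 := mul_le_mul_of_nonneg_right (le_max_left δ 0) (abs_nonneg τ)
    linarith
  induction k generalizing j with
  | zero => exact h0 j
  | succ k ih =>
    -- Chain rule: an `r`-derivative raises `j` by one and brings out `(√r)' = r^{-1/2} / 2`.
    have h1 := (SmoothDecay.rpow (1 / 2) (-(1 / 2)) k).mul (ih (j + 1))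
    rw [zero_add] at h1
    refine ⟨h0 j, _, fun r hr τ => ?_, h1⟩
    have h := (hasDerivAt_macdonaldLine (s := 0) (by simp) j (α + Complex.I * τ)
      (Real.sqrt_pos.2 hr)).scomp r (Real.hasDerivAt_sqrt hr.ne')
    refine h.congr_deriv ?_
    rw [Complex.real_smul, Real.rpow_neg hr.le, ← Real.sqrt_eq_rpow]
    congr 2
    ring

/-- The kernel `K_{α+iτ}(√r) K_{α-iτ}(√r)`. -/
def lebedevKernel (α r τ : ℝ) : ℂ :=
  macdonaldLine 0 0 (α + Complex.I * τ) (Real.sqrt r) *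
    macdonaldLine 0 0 (α + Complex.I * (-τ : ℝ)) (Real.sqrt r)

lemma smoothDecay_lebedevKernel (α : ℝ) (k : ℕ) : SmoothDecay Real.pi k (lebedevKernel α) := by
  have h := smoothDecay_macdonaldLine α 0 k
  have h' := h.mul h.comp_neg
  rw [add_halves] at h'
  exact h'

lemma macdonaldK_conj (μ : ℂ) (x : ℝ) :
    macdonaldK (starRingEnd ℂ μ) x = starRingEnd ℂ (macdonaldK μ x) := by
  unfold macdonaldK
  rw [← integral_conj]
  congr 1
  ext t
  rw [map_mul, Complex.conj_ofReal, ← Complex.cosh_conj, map_mul, Complex.conj_ofReal]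

lemma lebedevKernel_eq_norm_sq (α : ℝ) {r : ℝ} (hr : 0 < r) (τ : ℝ) :
    lebedevKernel α r τ = ((‖macdonaldK (α + Complex.I * τ) (Real.sqrt r)‖ ^ 2 : ℝ) : ℂ) := by
  have hx := Real.sqrt_pos.2 hr
  rw [lebedevKernel, ← macdonaldK_eq_macdonaldLine _ hx, ← macdonaldK_eq_macdonaldLine _ hx]
  have : (α : ℂ) + Complex.I * (-τ : ℝ) = starRingEnd ℂ (α + Complex.I * τ) := by
    simp
  rw [this, macdonaldK_conj, Complex.mul_conj, Complex.normSq_eq_norm_sq]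

/-! ### Fourth order equation for the product -/

lemma HasDerivAt.eq_of_eqOn_Ioi {f g : ℝ → ℂ} {f' g' : ℂ} {r : ℝ} (hr : 0 < r)
    (hfg : ∀ ρ, 0 < ρ → f ρ = g ρ) (hf : HasDerivAt f f' r) (hg : HasDerivAt g g' r) :
    f' = g' := by
  refine hf.unique (hg.congr_of_eventuallyEq ?_)
  filter_upwards [Ioi_mem_nhds hr] with ρ hρ using hfg ρ hρ

/-- The fourth order equation satisfied by the product of two solutions `f`, `h` of
`4 r² y'' + 4 r y' = (r + M) y` and `4 r² y'' + 4 r y' = (r + N) y`. -/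
lemma product_ode {f p h q W₁ W₂ W₃ W₄ : ℝ → ℂ} {M N a T : ℂ}
    (hf : ∀ r, 0 < r → HasDerivAt f (p r) r)
    (hp : ∀ r : ℝ, 0 < r → HasDerivAt p (((r + M) * f r - 4 * r * p r) / (4 * r ^ 2)) r)
    (hh : ∀ r, 0 < r → HasDerivAt h (q r) r)
    (hq : ∀ r : ℝ, 0 < r → HasDerivAt q (((r + N) * h r - 4 * r * q r) / (4 * r ^ 2)) r)
    (hW₁ : ∀ r, 0 < r → HasDerivAt (fun r => f r * h r) (W₁ r) r)
    (hW₂ : ∀ r, 0 < r → HasDerivAt W₁ (W₂ r) r)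
    (hW₃ : ∀ r, 0 < r → HasDerivAt W₂ (W₃ r) r)
    (hW₄ : ∀ r, 0 < r → HasDerivAt W₃ (W₄ r) r)
    (hadd : M + N = 2 * (a - T)) (hmul : M * N = (a + T) ^ 2) {r : ℝ} (hr : 0 < r) :
    (r : ℂ) ^ 3 * W₄ r + r * (T * W₂ r) + 6 * r ^ 2 * W₃ r + T * W₁ r
      + r * (7 - a - r) * W₂ r - a / r * (T * (f r * h r)) + (1 - a - 5 / 2 * r) * W₁ r
      - f r * h r / 2 = 0 := by
  have hid : ∀ r : ℝ, HasDerivAt (fun r : ℝ => (r : ℂ)) 1 r := fun r => by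
    simpa using (hasDerivAt_id r).ofReal_comp
  have e₁ : ∀ r, 0 < r → W₁ r = p r * h r + f r * q r := fun r hr =>
    (hW₁ r hr).unique ((hf r hr).mul (hh r hr))
  -- This relation expresses `p q` through `f h`, `W₁` and `W₂`.
  have e₂ : ∀ r : ℝ, 0 < r → (r : ℂ) ^ 2 * W₂ r
      = (2 * r + (M + N)) / 4 * (f r * h r) - r * W₁ r + 2 * (r ^ 2 * (p r * q r)) := by
    intro r hr
    have hrc : (r : ℂ) ≠ 0 := by exact_mod_cast hr.ne'
    have h2 := HasDerivAt.eq_of_eqOn_Ioi hr e₁ (hW₂ r hr)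
      (((hp r hr).mul (hh r hr)).add ((hf r hr).mul (hq r hr)))
    rw [h2, e₁ r hr]
    field_simp
    ring
  -- Differentiated `e₂`, times `r`. The only terms not symmetric in the factors are `M f q + N p
  -- h`; with the prefactor `r` they cancel from the next derivative, leaving `p q` and `f h`.
  have e₃ : ∀ r : ℝ, 0 < r → (r : ℂ) ^ 3 * W₃ r + 3 * r ^ 2 * W₂ r
      = r * (f r * h r) / 2 + (2 * r ^ 2 + (M + N) * r) / 4 * W₁ r - r * W₁ r + r ^ 2 * W₁ r / 2
        + r * (M * (f r * q r) + N * (p r * h r)) / 2 := by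
    intro r hr
    have hrc : (r : ℂ) ≠ 0 := by exact_mod_cast hr.ne'
    have hl := ((hid r).pow 2).mul (hW₃ r hr)
    have hr' := ((((((hid r).const_mul 2).add_const (M + N)).div_const 4).mul (hW₁ r hr)).sub
      ((hid r).mul (hW₂ r hr))).add
      ((((hid r).pow 2).mul ((hp r hr).mul (hq r hr))).const_mul 2)
    have h3 := HasDerivAt.eq_of_eqOn_Ioi hr e₂ hl hr'
    simp only [Nat.cast_ofNat, Nat.add_one_sub_one, pow_one, mul_one, one_mul, Pi.mul_apply,
      Pi.pow_apply] at h3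
    rw [e₁ r hr] at h3 ⊢
    field_simp at h3 ⊢
    linear_combination 2 * h3
  have hrc : (r : ℂ) ≠ 0 := by exact_mod_cast hr.ne'
  have hl := (((hid r).pow 3).mul (hW₄ r hr)).add
    ((((hid r).pow 2).const_mul 3).mul (hW₃ r hr))
  have hr' := ((((((hid r).mul (hW₁ r hr)).div_const 2).add
    ((((((hid r).pow 2).const_mul 2).add ((hid r).const_mul (M + N))).div_const 4).mul
      (hW₂ r hr))).sub ((hid r).mul (hW₂ r hr))).add
    ((((hid r).pow 2).mul (hW₂ r hr)).div_const 2)).add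
    (((hid r).mul ((((hf r hr).mul (hq r hr)).const_mul M).add
      (((hp r hr).mul (hh r hr)).const_mul N))).div_const 2)
  have h4 := HasDerivAt.eq_of_eqOn_Ioi hr e₃ hl hr'
  have h2 := e₂ r hr
  simp only [Nat.cast_ofNat, Nat.add_one_sub_one, pow_one, mul_one, one_mul, Pi.mul_apply,
    Pi.pow_apply, Pi.add_apply] at h4
  rw [e₁ r hr] at h2 h4 ⊢
  obtain rfl : N = 2 * (a - T) - M := by linear_combination hadd
  -- `h2` removes `p q` and `hmul` removes `M N`. What is left of the squares is `(a + T)² - (a -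
  -- T)² = 4aT`, so `T` enters only linearly.
  linear_combination (norm := (field_simp; ring))
    h4 - (a - T) / (2 * r) * h2 + f r * h r / (4 * r) * hmul

/-! ### Transforms with a decaying kernel: differentiation under the integral -/

/-- The transform `∫ F(r, τ) e^{θτ} g(τ) dτ` with kernel `F`. -/
def kernelTransform (g : ℝ → ℂ) (F : ℝ → ℝ → ℂ) (r θ : ℝ) : ℂ :=
  ∫ τ : ℝ, F r τ * (Real.exp (θ * τ) : ℂ) * g τ

section transform

variable {β : ℝ} {g : ℝ → ℂ}

lemma aestronglyMeasurable_of_integrable_exp_mul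
    (hg : Integrable (fun τ : ℝ => (Real.exp ((β - Real.pi) * |τ|) : ℂ) * g τ)) :
    AEStronglyMeasurable g := by
  have hc : Continuous (fun τ : ℝ => (Real.exp (-((β - Real.pi) * |τ|)) : ℂ)) := by fun_prop
  refine (hc.aestronglyMeasurable.mul hg.aestronglyMeasurable).congr
    (Filter.Eventually.of_forall fun τ => ?_)
  simp only [Pi.mul_apply]
  rw [← mul_assoc, ← Complex.ofReal_mul, ← Real.exp_add]
  simp

lemma aestronglyMeasurable_kernel
    (hg : Integrable (fun τ : ℝ => (Real.exp ((β - Real.pi) * |τ|) : ℂ) * g τ))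
    {F : ℝ → ℝ → ℂ} (hF : HasExpDecay Real.pi F) {r : ℝ} (hr : 0 < r) (θ : ℝ) :
    AEStronglyMeasurable (fun τ : ℝ => F r τ * (Real.exp (θ * τ) : ℂ) * g τ) := by
  have hc : Continuous (fun τ : ℝ => (Real.exp (θ * τ) : ℂ)) := by fun_prop
  exact ((hF.1 r hr).aestronglyMeasurable.mul hc.aestronglyMeasurable).mul
    (aestronglyMeasurable_of_integrable_exp_mul hg)

lemma norm_mul_exp_mul_le {z w : ℂ} {θ c δ τ C : ℝ} (hθ : |θ| ≤ c)
    (hδ : c - δ ≤ β - Real.pi) (hz : ‖z‖ ≤ C * Real.exp (-δ * |τ|)) (hC : 0 ≤ C) :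
    ‖z * (Real.exp (θ * τ) : ℂ) * w‖
      ≤ C * ‖(Real.exp ((β - Real.pi) * |τ|) : ℂ) * w‖ := by
  rw [norm_mul, norm_mul, norm_mul, ← mul_assoc, Complex.norm_real, Complex.norm_real,
    Real.norm_of_nonneg (Real.exp_pos _).le, Real.norm_of_nonneg (Real.exp_pos _).le]
  refine mul_le_mul_of_nonneg_right ?_ (norm_nonneg w)
  refine (mul_le_mul_of_nonneg_right hz (Real.exp_pos _).le).trans ?_
  rw [mul_assoc, ← Real.exp_add]
  refine mul_le_mul_of_nonneg_left (Real.exp_le_exp.2 ?_) hC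
  have h1 : θ * τ ≤ c * |τ| := (le_abs_self _).trans
    ((abs_mul θ τ).le.trans (mul_le_mul_of_nonneg_right hθ (abs_nonneg τ)))
  have h2 := mul_le_mul_of_nonneg_right hδ (abs_nonneg τ)
  linarith

lemma HasExpDecay.exists_bound {F : ℝ → ℝ → ℂ} (hF : HasExpDecay Real.pi F) {a c : ℝ} (b : ℝ)
    (ha : 0 < a) (hc : c < β) (g : ℝ → ℂ) :
    ∃ C, ∀ r ∈ Icc a b, ∀ θ, |θ| ≤ c → ∀ τ, ‖F r τ * (Real.exp (θ * τ) : ℂ) * g τ‖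
      ≤ C * ‖(Real.exp ((β - Real.pi) * |τ|) : ℂ) * g τ‖ := by
  -- The rate `δ` with `c - δ = β - π`; it is below `π` because `c < β`.
  obtain ⟨C, hC⟩ := hF.2 a b (Real.pi - (β - c)) ha (by linarith)
  refine ⟨C, fun r hr θ hθ τ => norm_mul_exp_mul_le hθ (by linarith) (hC r hr τ) ?_⟩
  have h := (norm_nonneg _).trans (hC r hr τ)
  exact nonneg_of_mul_nonneg_left h (Real.exp_pos _)

lemma integrable_kernel
    (hg : Integrable (fun τ : ℝ => (Real.exp ((β - Real.pi) * |τ|) : ℂ) * g τ))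
    {F : ℝ → ℝ → ℂ} (hF : HasExpDecay Real.pi F) {r θ : ℝ} (hr : 0 < r) (hθ : |θ| < β) :
    Integrable (fun τ : ℝ => F r τ * (Real.exp (θ * τ) : ℂ) * g τ) := by
  obtain ⟨C, hC⟩ := hF.exists_bound r hr hθ g
  exact (hg.norm.const_mul C).mono' (aestronglyMeasurable_kernel hg hF hr θ)
    (Filter.Eventually.of_forall fun τ => hC r ⟨le_rfl, le_rfl⟩ θ le_rfl τ)

/-- The real-linear map `(x, y) ↦ x a + y b`. -/
def linearOfPartials : ℂ × ℂ →L[ℝ] (ℝ × ℝ →L[ℝ] ℂ) :=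
  (ContinuousLinearMap.smulRightL ℝ (ℝ × ℝ) ℂ (ContinuousLinearMap.fst ℝ ℝ ℝ)).comp
      (ContinuousLinearMap.fst ℝ ℂ ℂ) +
    (ContinuousLinearMap.smulRightL ℝ (ℝ × ℝ) ℂ (ContinuousLinearMap.snd ℝ ℝ ℝ)).comp
      (ContinuousLinearMap.snd ℝ ℂ ℂ)

lemma linearOfPartials_apply (v : ℂ × ℂ) (p : ℝ × ℝ) :
    linearOfPartials v p = (p.1 : ℂ) * v.1 + (p.2 : ℂ) * v.2 := by
  simp [linearOfPartials]

lemma norm_linearOfPartials_le (v : ℂ × ℂ) : ‖linearOfPartials v‖ ≤ ‖v.1‖ + ‖v.2‖ := by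
  refine ContinuousLinearMap.opNorm_le_bound _ (by positivity) fun p => ?_
  rw [linearOfPartials_apply]
  refine (norm_add_le _ _).trans ?_
  rw [norm_mul, norm_mul, Complex.norm_real, Complex.norm_real, add_mul]
  have h1 := norm_fst_le p
  have h2 := norm_snd_le p
  rw [mul_comm ‖v.1‖, mul_comm ‖v.2‖]
  gcongr

/-- The joint derivative is taken at once, by domination on a box around `(r, θ)`. Both partials are
again transforms, with kernels `F'` and `τ F`, so the statement can be iterated. -/
lemma hasFDerivAt_kernelTransform
    (hg : Integrable (fun τ : ℝ => (Real.exp ((β - Real.pi) * |τ|) : ℂ) * g τ))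
    {F F' : ℝ → ℝ → ℂ} (hF : SmoothDecay Real.pi 0 F) (hF' : HasExpDecay Real.pi F')
    (hd : ∀ r, 0 < r → ∀ τ, HasDerivAt (fun ρ => F ρ τ) (F' r τ) r)
    {r θ : ℝ} (hr : 0 < r) (hθ : |θ| < β) :
    HasFDerivAt (fun p : ℝ × ℝ => kernelTransform g F p.1 p.2)
      (linearOfPartials (kernelTransform g F' r θ,
        kernelTransform g (fun r τ => (τ : ℂ) ^ 1 * F r τ) r θ)) (r, θ) := by
  have hτF : HasExpDecay Real.pi (fun r τ => (τ : ℂ) ^ 1 * F r τ) := hF.id_pow_mul 1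
  obtain ⟨c, hθc, hcβ⟩ := exists_between hθ
  obtain ⟨C₁, hC₁⟩ := hF'.exists_bound (2 * r) (half_pos hr) hcβ g
  obtain ⟨C₂, hC₂⟩ := hτF.exists_bound (2 * r) (half_pos hr) hcβ g
  have i₁ := integrable_kernel hg hF' hr hθ
  have i₂ := integrable_kernel hg hτF hr hθ
  have h := hasFDerivAt_integral_of_dominated_of_fderiv_le (μ := volume) (𝕜 := ℝ)
    (F := fun (p : ℝ × ℝ) τ => F p.1 τ * (Real.exp (p.2 * τ) : ℂ) * g τ) (x₀ := (r, θ))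
    (F' := fun p τ => linearOfPartials (F' p.1 τ * (Real.exp (p.2 * τ) : ℂ) * g τ,
      (τ : ℂ) ^ 1 * F p.1 τ * (Real.exp (p.2 * τ) : ℂ) * g τ))
    (s := Ioo (r / 2) (2 * r) ×ˢ Ioo (-c) c)
    (bound := fun τ => C₁ * ‖(Real.exp ((β - Real.pi) * |τ|) : ℂ) * g τ‖
      + C₂ * ‖(Real.exp ((β - Real.pi) * |τ|) : ℂ) * g τ‖)
    (prod_mem_nhds (Ioo_mem_nhds (by linarith) (by linarith))
      (Ioo_mem_nhds (abs_lt.1 hθc).1 (abs_lt.1 hθc).2)) ?_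
    (integrable_kernel hg hF hr hθ)
    (linearOfPartials.continuous.comp_aestronglyMeasurable
      (i₁.aestronglyMeasurable.prodMk i₂.aestronglyMeasurable)) ?_
    ((hg.norm.const_mul C₁).add (hg.norm.const_mul C₂)) ?_
  · rw [ContinuousLinearMap.integral_comp_comm _ (i₁.prodMk i₂)] at h
    rw [integral_pair i₁ i₂] at h
    exact h
  · have hm : ∀ᶠ p : ℝ × ℝ in nhds (r, θ), 0 < p.1 :=
      continuous_fst.continuousAt.eventually (Ioi_mem_nhds hr)
    exact hm.mono fun p hp => aestronglyMeasurable_kernel hg hF hp p.2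
  · refine Filter.Eventually.of_forall fun τ p hp => (norm_linearOfPartials_le _).trans ?_
    exact add_le_add (hC₁ _ (Ioo_subset_Icc_self hp.1) _ (abs_lt.2 hp.2).le τ)
      (hC₂ _ (Ioo_subset_Icc_self hp.1) _ (abs_lt.2 hp.2).le τ)
  · refine Filter.Eventually.of_forall fun τ p hp => ?_
    have hp1 : 0 < p.1 := lt_trans (half_pos hr) hp.1.1
    have h1 := (hd p.1 hp1 τ).hasFDerivAt.comp p hasFDerivAt_fst
    have h2 := (((hasDerivAt_id p.2).mul_const τ).exp.ofReal_comp).hasFDerivAt.comp p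
      hasFDerivAt_snd
    refine ((h1.mul h2).mul_const (g τ)).congr_fderiv ?_
    ext
    · simp [linearOfPartials_apply]
      ring
    · simp [linearOfPartials_apply]
      ring

/-- The derivative is a fixed linear map applied to two transforms whose kernels have one order
less. The extra order in `k + 1` pays for continuity in the base case. -/
lemma contDiffOn_kernelTransform
    (hg : Integrable (fun τ : ℝ => (Real.exp ((β - Real.pi) * |τ|) : ℂ) * g τ))
    {F : ℝ → ℝ → ℂ} {k : ℕ} (hF : SmoothDecay Real.pi (k + 1) F) :
    ContDiffOn ℝ k (fun p : ℝ × ℝ => kernelTransform g F p.1 p.2)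
      (Ioi 0 ×ˢ Ioo (-β) β) := by
  have hopen : IsOpen (Ioi (0 : ℝ) ×ˢ Ioo (-β) β) := isOpen_Ioi.prod isOpen_Ioo
  induction k generalizing F with
  | zero =>
    obtain ⟨h0, F', hd, h1⟩ := hF
    refine contDiffOn_zero.2 fun p hp => ?_
    exact (hasFDerivAt_kernelTransform hg h0 h1 hd hp.1
      (abs_lt.2 hp.2)).continuousAt.continuousWithinAt
  | succ k ih =>
    have hτ := (hF.of_succ).id_pow_mul 1
    obtain ⟨h0, F', hd, h1⟩ := hF
    have hder := fun (p : ℝ × ℝ) (hp : p ∈ Ioi (0 : ℝ) ×ˢ Ioo (-β) β) =>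
      hasFDerivAt_kernelTransform hg h0 h1.hasExpDecay hd hp.1 (abs_lt.2 hp.2)
    rw [Nat.cast_add, Nat.cast_one, contDiffOn_succ_iff_fderiv_of_isOpen hopen]
    refine ⟨fun p hp => (hder p hp).differentiableAt.differentiableWithinAt, by simp, ?_⟩
    exact (linearOfPartials.contDiff.comp_contDiffOn ((ih h1).prodMk (ih hτ))).congr
      fun p hp => (hder p hp).fderiv

lemma hasDerivAt_kernelTransform_fst
    (hg : Integrable (fun τ : ℝ => (Real.exp ((β - Real.pi) * |τ|) : ℂ) * g τ))
    {F F' : ℝ → ℝ → ℂ} (hF : SmoothDecay Real.pi 0 F) (hF' : HasExpDecay Real.pi F')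
    (hd : ∀ r, 0 < r → ∀ τ, HasDerivAt (fun ρ => F ρ τ) (F' r τ) r)
    {r θ : ℝ} (hr : 0 < r) (hθ : |θ| < β) :
    HasDerivAt (fun ρ => kernelTransform g F ρ θ) (kernelTransform g F' r θ) r := by
  have h := (hasFDerivAt_kernelTransform hg hF hF' hd hr hθ).comp_hasDerivAt r
    ((hasDerivAt_id r).prodMk (hasDerivAt_const r θ))
  simpa [linearOfPartials_apply, Function.comp_def] using h

lemma hasDerivAt_kernelTransform_snd
    (hg : Integrable (fun τ : ℝ => (Real.exp ((β - Real.pi) * |τ|) : ℂ) * g τ))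
    {F : ℝ → ℝ → ℂ} (hF : SmoothDecay Real.pi 1 F) {r θ : ℝ} (hr : 0 < r) (hθ : |θ| < β) :
    HasDerivAt (fun ϑ => kernelTransform g F r ϑ)
      (kernelTransform g (fun r τ => (τ : ℂ) ^ 1 * F r τ) r θ) θ := by
  obtain ⟨h0, F', hd, h1⟩ := hF
  have h := (hasFDerivAt_kernelTransform hg h0 h1 hd hr hθ).comp_hasDerivAt θ
    ((hasDerivAt_const θ r).prodMk (hasDerivAt_id θ))
  simpa [linearOfPartials_apply, Function.comp_def] using h

lemma iteratedDeriv_kernelTransform_snd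
    (hg : Integrable (fun τ : ℝ => (Real.exp ((β - Real.pi) * |τ|) : ℂ) * g τ))
    {F : ℝ → ℝ → ℂ} (hF : SmoothDecay Real.pi 1 F) (n : ℕ) {r θ : ℝ} (hr : 0 < r)
    (hθ : |θ| < β) :
    iteratedDeriv n (fun ϑ => kernelTransform g F r ϑ) θ
      = kernelTransform g (fun r τ => (τ : ℂ) ^ n * F r τ) r θ := by
  induction n generalizing θ with
  | zero => simp
  | succ n ih =>
    have hev : iteratedDeriv n (fun ϑ => kernelTransform g F r ϑ) =ᶠ[nhds θ]
        fun ϑ => kernelTransform g (fun r τ => (τ : ℂ) ^ n * F r τ) r ϑ := by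
      filter_upwards [Ioo_mem_nhds (abs_lt.1 hθ).1 (abs_lt.1 hθ).2] with ϑ hϑ
        using ih (abs_lt.2 hϑ)
    rw [iteratedDeriv_succ, hev.deriv_eq,
      (hasDerivAt_kernelTransform_snd hg (hF.id_pow_mul n) hr hθ).deriv]
    congr 1
    ext r τ
    ring

lemma iteratedDeriv_succ_kernelTransform_fst
    (hg : Integrable (fun τ : ℝ => (Real.exp ((β - Real.pi) * |τ|) : ℂ) * g τ))
    {F F' : ℝ → ℝ → ℂ} (hF : SmoothDecay Real.pi 0 F) (hF' : HasExpDecay Real.pi F')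
    (hd : ∀ r, 0 < r → ∀ τ, HasDerivAt (fun ρ => F ρ τ) (F' r τ) r)
    (m : ℕ) {r θ : ℝ} (hr : 0 < r) (hθ : |θ| < β) :
    iteratedDeriv (m + 1) (fun ρ => kernelTransform g F ρ θ) r
      = iteratedDeriv m (fun ρ => kernelTransform g F' ρ θ) r := by
  rw [iteratedDeriv_succ']
  refine Filter.EventuallyEq.iteratedDeriv_eq m ?_
  filter_upwards [Ioi_mem_nhds hr] with ρ hρ
    using (hasDerivAt_kernelTransform_fst hg hF hF' hd hρ hθ).deriv

end transform

/-! ### The differential equation and the limit at infinity -/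

lemma lebedevIntegrand_eq (α : ℝ) (g : ℝ → ℂ) {r : ℝ} (hr : 0 < r) (θ τ : ℝ) :
    lebedevIntegrand α g r θ τ = lebedevKernel α r τ * (Real.exp (θ * τ) : ℂ) * g τ := by
  rw [lebedevIntegrand, lebedevKernel_eq_norm_sq α hr, mul_comm (Real.exp (θ * τ)),
    Complex.ofReal_mul]

lemma lebedevPsi_eq (α : ℝ) (g : ℝ → ℂ) {r : ℝ} (hr : 0 < r) (θ : ℝ) :
    lebedevPsi α g r θ = kernelTransform g (lebedevKernel α) r θ := by
  rw [lebedevPsi, kernelTransform]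
  congr 1
  ext τ
  exact lebedevIntegrand_eq α g hr θ τ

/-- `macdonaldLine 0 0 μ (√r)` solves `4 r² y'' + 4 r y' = (r + μ²) y`. -/
lemma hasDerivAt_macdonaldLine_sqrt (μ : ℂ) {r : ℝ} (hr : 0 < r) :
    HasDerivAt (fun ρ : ℝ => macdonaldLine 0 0 μ (Real.sqrt ρ))
      (macdonaldLine 0 1 μ (Real.sqrt r) / (2 * Real.sqrt r : ℝ)) r ∧
    HasDerivAt (fun ρ : ℝ => macdonaldLine 0 1 μ (Real.sqrt ρ) / (2 * Real.sqrt ρ : ℝ))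
      (((r + μ ^ 2) * macdonaldLine 0 0 μ (Real.sqrt r)
        - 4 * r * (macdonaldLine 0 1 μ (Real.sqrt r) / (2 * Real.sqrt r : ℝ))) / (4 * r ^ 2))
      r := by
  have hx := Real.sqrt_pos.2 hr
  have hs := Real.hasDerivAt_sqrt hr.ne'
  have h0 := (hasDerivAt_macdonaldLine (s := 0) (by simp) 0 μ hx).scomp r hs
  have h1 := (hasDerivAt_macdonaldLine (s := 0) (by simp) 1 μ hx).scomp r hs
  have h2 := (hs.const_mul 2).ofReal_comp
  have hb := macdonaldLine_bessel μ hx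
  have hsq : ((Real.sqrt r : ℝ) : ℂ) ^ 2 = r := by exact_mod_cast Real.sq_sqrt hr.le
  have hne : ((Real.sqrt r : ℝ) : ℂ) ≠ 0 := by exact_mod_cast hx.ne'
  refine ⟨h0.congr_deriv ?_, (h1.div h2 (by exact_mod_cast (mul_pos two_pos hx).ne')).congr_deriv
    ?_⟩
  · rw [Complex.real_smul]
    push_cast
    ring
  · simp only [Function.comp_apply, Complex.real_smul]
    rw [← hsq]
    push_cast
    field_simp
    linear_combination 4 * hb

lemma sum_mul_integral_eq_zero {ι : Type*} [Fintype ι] (c : ι → ℂ) (G : ι → ℝ → ℂ)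
    (hG : ∀ i, Integrable (G i)) (h : ∀ τ, ∑ i, c i * G i τ = 0) :
    ∑ i, c i * ∫ τ, G i τ = 0 := by
  simp_rw [← integral_const_mul]
  rw [← integral_finsetSum _ fun i _ => (hG i).const_mul _]
  simp [h]

lemma polarDeriv_lebedevPsi {β : ℝ} {g : ℝ → ℂ} (α : ℝ)
    (hg : Integrable (fun τ : ℝ => (Real.exp ((β - Real.pi) * |τ|) : ℂ) * g τ)) (m n : ℕ)
    {r θ : ℝ} (hr : 0 < r) (hθ : |θ| < β) :
    polarDeriv m n (lebedevPsi α g) r θ = iteratedDeriv m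
      (fun ρ => kernelTransform g (fun r τ => (τ : ℂ) ^ n * lebedevKernel α r τ) ρ θ) r := by
  refine Filter.EventuallyEq.iteratedDeriv_eq m ?_
  filter_upwards [Ioi_mem_nhds hr] with ρ hρ
  rw [← iteratedDeriv_kernelTransform_snd hg (smoothDecay_lebedevKernel α 1) n hρ hθ]
  congr 1
  ext ϑ
  exact lebedevPsi_eq α g hρ ϑ

/-- Each `∂/∂θ` multiplies the kernel by `τ` and each `∂/∂r` differentiates it, so the operator
passes to the integrand, which vanishes pointwise by `product_ode`. -/
lemma lebedevOperator_lebedevPsi {β : ℝ} {g : ℝ → ℂ} (α : ℝ)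
    (hg : Integrable (fun τ : ℝ => (Real.exp ((β - Real.pi) * |τ|) : ℂ) * g τ))
    {r θ : ℝ} (hr : 0 < r) (hθ : |θ| < β) :
    lebedevOperator α (lebedevPsi α g) r θ = 0 := by
  obtain ⟨s0, W₁, d₁, hs⟩ := smoothDecay_lebedevKernel α 4
  have t₁ := fun n => (hs.id_pow_mul n).hasExpDecay
  obtain ⟨s1, W₂, d₂, hs⟩ := hs
  have t₂ := fun n => (hs.id_pow_mul n).hasExpDecay
  obtain ⟨s2, W₃, d₃, hs⟩ := hs
  have t₃ := fun n => (hs.id_pow_mul n).hasExpDecay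
  obtain ⟨s3, W₄, d₄, hs⟩ := hs
  have t₄ := fun n => (hs.id_pow_mul n).hasExpDecay
  have t₀ : ∀ n, HasExpDecay Real.pi (fun r τ => (τ : ℂ) ^ n * lebedevKernel α r τ) :=
    fun n => SmoothDecay.id_pow_mul (k := 0) s0 n
  have step : ∀ {F F' : ℝ → ℝ → ℂ} (n m : ℕ),
      HasExpDecay Real.pi (fun r τ => (τ : ℂ) ^ n * F r τ) →
      HasExpDecay Real.pi (fun r τ => (τ : ℂ) ^ n * F' r τ) →
      (∀ r, 0 < r → ∀ τ, HasDerivAt (fun ρ => F ρ τ) (F' r τ) r) →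
      iteratedDeriv (m + 1)
          (fun ρ => kernelTransform g (fun r τ => (τ : ℂ) ^ n * F r τ) ρ θ) r
        = iteratedDeriv m
          (fun ρ => kernelTransform g (fun r τ => (τ : ℂ) ^ n * F' r τ) ρ θ) r :=
    fun n m hF hF' hd => iteratedDeriv_succ_kernelTransform_fst hg hF hF'
      (fun r hr τ => (hd r hr τ).const_mul _) m hr hθ
  have p1 : ∀ n, polarDeriv 1 n (lebedevPsi α g) r θ
      = kernelTransform g (fun r τ => (τ : ℂ) ^ n * W₁ r τ) r θ := fun n => by
    rw [polarDeriv_lebedevPsi α hg 1 n hr hθ, step n 0 (t₀ n) (t₁ n) d₁, iteratedDeriv_zero]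
  have p2 : ∀ n, polarDeriv 2 n (lebedevPsi α g) r θ
      = kernelTransform g (fun r τ => (τ : ℂ) ^ n * W₂ r τ) r θ := fun n => by
    rw [polarDeriv_lebedevPsi α hg 2 n hr hθ, step n 1 (t₀ n) (t₁ n) d₁,
      step n 0 (t₁ n) (t₂ n) d₂, iteratedDeriv_zero]
  have p3 : ∀ n, polarDeriv 3 n (lebedevPsi α g) r θ
      = kernelTransform g (fun r τ => (τ : ℂ) ^ n * W₃ r τ) r θ := fun n => by
    rw [polarDeriv_lebedevPsi α hg 3 n hr hθ, step n 2 (t₀ n) (t₁ n) d₁,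
      step n 1 (t₁ n) (t₂ n) d₂, step n 0 (t₂ n) (t₃ n) d₃, iteratedDeriv_zero]
  have p4 : ∀ n, polarDeriv 4 n (lebedevPsi α g) r θ
      = kernelTransform g (fun r τ => (τ : ℂ) ^ n * W₄ r τ) r θ := fun n => by
    rw [polarDeriv_lebedevPsi α hg 4 n hr hθ, step n 3 (t₀ n) (t₁ n) d₁,
      step n 2 (t₁ n) (t₂ n) d₂, step n 1 (t₂ n) (t₃ n) d₃, step n 0 (t₃ n) (t₄ n) d₄,
      iteratedDeriv_zero]
  have p0 : ∀ n, polarDeriv 0 n (lebedevPsi α g) r θ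
      = kernelTransform g (fun r τ => (τ : ℂ) ^ n * lebedevKernel α r τ) r θ := fun n => by
    rw [polarDeriv_lebedevPsi α hg 0 n hr hθ, iteratedDeriv_zero]
  have pp : lebedevPsi α g r θ
      = kernelTransform g (fun r τ => (τ : ℂ) ^ 0 * lebedevKernel α r τ) r θ := by
    rw [← p0 0]; simp [polarDeriv]
  rw [lebedevOperator, p4, p2, p3, p1, p2, p0, p1, pp]
  have key := sum_mul_integral_eq_zero
    ![(r : ℂ) ^ 3, (r : ℂ), 6 * (r : ℂ) ^ 2, 1, (r : ℂ) * (7 - (α : ℂ) ^ 2 - (r : ℂ)),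
      -((α : ℂ) ^ 2 / (r : ℂ)), 1 - (α : ℂ) ^ 2 - 5 / 2 * (r : ℂ), -1 / 2]
    ![fun τ : ℝ => (τ : ℂ) ^ 0 * W₄ r τ * (Real.exp (θ * τ) : ℂ) * g τ,
      fun τ : ℝ => (τ : ℂ) ^ 2 * W₂ r τ * (Real.exp (θ * τ) : ℂ) * g τ,
      fun τ : ℝ => (τ : ℂ) ^ 0 * W₃ r τ * (Real.exp (θ * τ) : ℂ) * g τ,
      fun τ : ℝ => (τ : ℂ) ^ 2 * W₁ r τ * (Real.exp (θ * τ) : ℂ) * g τ,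
      fun τ : ℝ => (τ : ℂ) ^ 0 * W₂ r τ * (Real.exp (θ * τ) : ℂ) * g τ,
      fun τ : ℝ => (τ : ℂ) ^ 2 * lebedevKernel α r τ * (Real.exp (θ * τ) : ℂ) * g τ,
      fun τ : ℝ => (τ : ℂ) ^ 0 * W₁ r τ * (Real.exp (θ * τ) : ℂ) * g τ,
      fun τ : ℝ => (τ : ℂ) ^ 0 * lebedevKernel α r τ * (Real.exp (θ * τ) : ℂ) * g τ]
    (by
      intro i
      fin_cases i
      · exact integrable_kernel hg (t₄ 0) hr hθ
      · exact integrable_kernel hg (t₂ 2) hr hθ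
      · exact integrable_kernel hg (t₃ 0) hr hθ
      · exact integrable_kernel hg (t₁ 2) hr hθ
      · exact integrable_kernel hg (t₂ 0) hr hθ
      · exact integrable_kernel hg (t₀ 2) hr hθ
      · exact integrable_kernel hg (t₁ 0) hr hθ
      · exact integrable_kernel hg (t₀ 0) hr hθ)
    (by
      intro τ
      -- Here `M = (α + iτ)²` and `N = (α - iτ)²`, whence `M + N = 2(α² - τ²)` and `M N = (α² +
      -- τ²)²`.
      have hode := product_ode (a := (α : ℂ) ^ 2) (T := (τ : ℂ) ^ 2)
        (fun r hr => (hasDerivAt_macdonaldLine_sqrt (α + Complex.I * τ) hr).1)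
        (fun r hr => (hasDerivAt_macdonaldLine_sqrt (α + Complex.I * τ) hr).2)
        (fun r hr => (hasDerivAt_macdonaldLine_sqrt (α + Complex.I * (-τ : ℝ)) hr).1)
        (fun r hr => (hasDerivAt_macdonaldLine_sqrt (α + Complex.I * (-τ : ℝ)) hr).2)
        (fun r hr => d₁ r hr τ) (fun r hr => d₂ r hr τ) (fun r hr => d₃ r hr τ)
        (fun r hr => d₄ r hr τ)
        (by push_cast; linear_combination (2 * (τ : ℂ) ^ 2) * Complex.I_sq)
        (by
          push_cast
          linear_combination ((τ : ℂ) ^ 4 * (Complex.I ^ 2 - 1) - 2 * (α : ℂ) ^ 2 * τ ^ 2) *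
            Complex.I_sq) hr
      rw [← lebedevKernel] at hode
      simp only [Fin.sum_univ_eight, Fin.isValue, Matrix.cons_val]
      linear_combination ((Real.exp (θ * τ) : ℂ) * g τ) * hode)
  simp only [Fin.sum_univ_eight, Fin.isValue, Matrix.cons_val] at key
  simp only [kernelTransform]
  linear_combination key

lemma tendsto_lebedevPsi_atTop {β : ℝ} {g : ℝ → ℂ} (α : ℝ)
    (hg : Integrable (fun τ : ℝ => (Real.exp ((β - Real.pi) * |τ|) : ℂ) * g τ))
    {θ : ℝ} (hθ : |θ| < β) :
    Filter.Tendsto (fun r : ℝ => lebedevPsi α g r θ) Filter.atTop (nhds 0) := by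
  -- The two factors together decay like `e^{-2s|τ|}`, and `2s ≥ π - (β - |θ|)` is what the weight
  -- requires; `s < π/2` holds because `|θ| < β`.
  set s : ℝ := max 0 ((Real.pi - (β - |θ|)) / 2) with hs_def
  have hs0 : 0 ≤ s := le_max_left _ _
  have hs : s < Real.pi / 2 := max_lt (by positivity) (by linarith)
  have hs2 : (Real.pi - (β - |θ|)) / 2 ≤ s := le_max_right _ _
  have hcos : 0 < Real.cos s := cos_pos_of_abs_lt (by rwa [abs_of_nonneg hs0])
  set C : ℝ := ∫ t : ℝ, coshMajorant ((0 : ℕ) + |α|) (1 * Real.cos s) t with hC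
  have hC0 : 0 ≤ C := integral_nonneg fun t => (Real.exp_pos _).le
  set E : ℝ → ℝ := fun r => Real.exp (-((Real.sqrt r - 1) * Real.cos s)) with hE
  have hbound : ∀ r : ℝ, 1 ≤ r → ‖lebedevPsi α g r θ‖
      ≤ (E r * C) ^ 2 * ∫ τ : ℝ, ‖(Real.exp ((β - Real.pi) * |τ|) : ℂ) * g τ‖ := by
    intro r hr
    rw [lebedevPsi_eq α g (zero_lt_one.trans_le hr), ← integral_const_mul]
    refine norm_integral_le_of_norm_le (hg.norm.const_mul _)
      (Filter.Eventually.of_forall fun τ => ?_)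
    have h1 : ∀ τ : ℝ, ‖macdonaldLine 0 0 (α + Complex.I * τ) (Real.sqrt r)‖
        ≤ E r * C * Real.exp (-s * |τ|) := fun τ => by
      have h := norm_macdonaldLine_le_exp_abs α hs0 hs 0 one_pos (Real.one_le_sqrt.2 hr) τ
      calc _ ≤ _ := h
        _ = _ := by ring
    refine norm_mul_exp_mul_le (c := |θ|) (δ := 2 * s) le_rfl (by linarith) ?_ (by positivity)
    rw [lebedevKernel, norm_mul]
    have h2 := h1 (-τ)
    rw [abs_neg] at h2
    refine (mul_le_mul (h1 τ) h2 (norm_nonneg _) ((norm_nonneg _).trans (h1 τ))).trans_eq ?_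
    rw [mul_mul_mul_comm, ← Real.exp_add, ← sq]
    congr 2; ring
  have hlim : Filter.Tendsto E Filter.atTop (nhds 0) := by
    refine Real.tendsto_exp_atBot.comp (Filter.tendsto_neg_atTop_atBot.comp ?_)
    exact (Filter.tendsto_atTop_add_const_right _ (-1) Real.tendsto_sqrt_atTop).atTop_mul_const
      hcos
  have hlim2 := (((hlim.mul_const C).pow 2).mul_const
    (∫ τ : ℝ, ‖(Real.exp ((β - Real.pi) * |τ|) : ℂ) * g τ‖))
  rw [zero_mul, zero_pow two_ne_zero, zero_mul] at hlim2
  refine squeeze_zero_norm' ?_ hlim2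
  filter_upwards [Filter.eventually_ge_atTop 1] with r hr using hbound r hr

end

theorem theorem6 (α β : ℝ) (hβ0 : 0 < β) (hβ : β < 2 * Real.pi) (g : ℝ → ℂ)
    (hg : MeasureTheory.Integrable
      (fun τ : ℝ => (Real.exp ((β - Real.pi) * |τ|) : ℂ) * g τ) MeasureTheory.volume) :
    (∀ r : ℝ, 0 < r → ∀ θ ∈ Set.Ico (0 : ℝ) β,
      MeasureTheory.Integrable (fun τ : ℝ => lebedevIntegrand α g r θ τ) MeasureTheory.volume ∧
      ContDiffAt ℝ 4 (fun p : ℝ × ℝ => lebedevPsi α g p.1 p.2) (r, θ) ∧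
      lebedevOperator α (lebedevPsi α g) r θ = 0) ∧
    (∀ θ ∈ Set.Ico (0 : ℝ) β,
      Filter.Tendsto (fun r : ℝ => lebedevPsi α g r θ) Filter.atTop (nhds 0)) := by
  have habs : ∀ θ ∈ Set.Ico (0 : ℝ) β, |θ| < β := fun θ hθ => by
    rw [abs_of_nonneg hθ.1]; exact hθ.2
  refine ⟨fun r hr θ hθ => ⟨?_, ?_, lebedevOperator_lebedevPsi α hg hr (habs θ hθ)⟩,
    fun θ hθ => tendsto_lebedevPsi_atTop α hg (habs θ hθ)⟩
  · simp_rw [lebedevIntegrand_eq α g hr θ]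
    exact integrable_kernel hg (smoothDecay_lebedevKernel α 0) hr (habs θ hθ)
  · have hmem : Set.Ioi (0 : ℝ) ×ˢ Set.Ioo (-β) β ∈ nhds (r, θ) :=
      prod_mem_nhds (Ioi_mem_nhds hr)
        (Ioo_mem_nhds (abs_lt.1 (habs θ hθ)).1 (abs_lt.1 (habs θ hθ)).2)
    -- Five orders of decay in `r` give class `C⁴`.
    refine ((contDiffOn_kernelTransform hg
      (smoothDecay_lebedevKernel α 5)).contDiffAt hmem).congr_of_eventuallyEq ?_
    filter_upwards [hmem] with p hp using lebedevPsi_eq α g hp.1 p.2
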